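/- Let $f:\mathbb T^2\to\mathbb T^2$, $\mathbb T^2=\mathbb R^2/\mathbb Z^2$, be the Cat Map induced by $\begin{pmatrix}2&1\\1&1\end{pmatrix}$, with contraction and expansion rates $\mu=\frac{3-\sqrt5}{2}$ and $\lambda=\frac{3+\sqrt5}{2}$. Around the fixed point $(0,0)$ use the orthonormal coordinates $(x,y)$ in which the $x$-axis is the stable and the $y$-axis the unstable direction. Let $b,\beta,\sigma>0$, $\varepsilon\in\mathbb R$, $-\frac{\pi}{2}<\varphi<\frac{\pi}{2}$, put $a=\frac{\varepsilon}{1-\mu}$, and suppose that \begin{itemize} \item (B1) $\varepsilon>3\left(\sigma\sqrt{\frac{4\ln\lambda}{1-\mu^2}}+b\right)$, \item (B2) $\beta<\frac{\varepsilon}{7}$ and $\beta\le(\lambda-1)b$, \item (B3) $\frac14\beta>\frac{\varepsilon\sin\varphi}{1-\mu}+(b+\beta)\exp\left\{-\frac{(a+\beta)^2}{2\sigma^2}\right\}\tan\varphi$. \end{itemize} Let $W\subset U'\subset U$ be the open regions $$W=\{|x|<a,\ |y|<be^{-x^2/2\sigma^2}\},\qquad U'=\{|x|<a+\tfrac{\beta}{2},\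 |y|<(b+\beta)e^{-x^2/2\sigma^2}\},\qquad U=\{|x|<a+\beta,\ |y|<(b+\beta)e^{-x^2/2\sigma^2}\},$$ and suppose that the projection to $\mathbb T^2$ is injective on $U$, so that $W,U',U$ are regarded as subsets of $\mathbb T^2$. Let $V$ be any $C^\infty$ unit vector field on $\mathbb T^2$ that is tangent in $W$ to the curves $y=Ke^{-x^2/2\sigma^2}$, $K\in\mathbb R$, with $V(0,0)=(1,0)$, and that forms the constant angle $\varphi$ with the unstable direction outside $U'$, i.e. $V=\pm(\sin\varphi,\cos\varphi)$ there. For $p\in\mathbb T^2$ let $Q_p$ be the uniform distribution (with respect to arc length) on the piece of the integral curve of $V$ through $p$ that extends by arc length $\varepsilon$ on both sides of $p$, that is, the law of the point reached from $p$ at time $t$ along the flow of $V$ for $t$ uniformly distributed on $[-\varepsilon,\varepsilon]$. For a finite Borel measure $\nu$ on $\mathbb T^2$ put $\mathcal F_*\nu(A)=\int_{\mathbb T^2}Q_{f(p)}(A)\,d\nu(p)$ for Borel $A\subset\mathbb T^2$. Then there exist $N\in\mathbb N$ and $\eta>0$ such that for every finite Borel measure $\nu$ on $\mathbb T^2$,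 with $\nu|_{W^c}(A)=\nu(A\cap W^c)$, $$\mathcal F^N_*(\nu|_{W^c})(W)\ \ge\ \eta\,\nu(W^c).$$ -/

import Mathlib

open scoped ContDiff
open MeasureTheory

noncomputable section

namespace KinkedCat

/-- The two-torus `ℝ² / ℤ²`. -/
abbrev Torus : Type := UnitAddCircle × UnitAddCircle

/-- The Cat Map, given by the matrix with rows `(2, 1)` and `(1, 1)`, mod `1`. -/
def catMap (p : Torus) : Torus := (2 • p.1 + p.2, p.1 + p.2)

/-- The contracting eigenvalue `μ` of the Cat Map. -/
def contr : ℝ := (3 - √5) / 2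

/-- The expanding eigenvalue `λ` of the Cat Map. -/
def expan : ℝ := (3 + √5) / 2

/-- The slope `τ` of the unstable direction in the standard coordinates. -/
def tau : ℝ := (√5 - 1) / 2

/-- The stable-unstable coordinate frame around the fixed point `(0, 0)`: the pair `(x, y)` is sent
to the class mod `ℤ²` of `x • e_s + y • e_u`, where `e_s = (-τ, 1) / √(1 + τ²)` and
`e_u = (1, τ) / √(1 + τ²)` are the orthonormal stable and unstable eigenvectors. This is the
universal covering of the torus and a local isometry. -/
def frame (z : ℝ × ℝ) : Torus :=
  (((-tau * z.1 + z.2) / √(1 + tau ^ 2) : ℝ), ((z.1 + tau * z.2) / √(1 + tau ^ 2) : ℝ))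

/-- The Gaussian-shaped curve of level `K`, as the graph of a function of `x`. -/
def gauss (σ K x : ℝ) : ℝ := K * Real.exp (-x ^ 2 / (2 * σ ^ 2))

/-- The level of the unique Gaussian-shaped curve through `(x, y)`: the `K` with
`gauss σ K x = y`. -/
def level (σ : ℝ) (z : ℝ × ℝ) : ℝ := z.2 * Real.exp (z.1 ^ 2 / (2 * σ ^ 2))

/-- The open plane region bounded by `x = ±r` and `y = ± h exp (-x² / (2σ²))`. -/
def bump (σ r h : ℝ) : Set (ℝ × ℝ) := {z | |z.1| < r ∧ |z.2| < gauss σ h z.1}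

/-- `a = ε / (1 - μ)`. -/
def halfLength (ε : ℝ) : ℝ := ε / (1 - contr)

/-- `W` in the stable-unstable coordinates. -/
def regionW (ε b σ : ℝ) : Set (ℝ × ℝ) := bump σ (halfLength ε) b

/-- `U'` in the stable-unstable coordinates. -/
def regionU' (ε b β σ : ℝ) : Set (ℝ × ℝ) := bump σ (halfLength ε + β / 2) (b + β)

/-- `U` in the stable-unstable coordinates. -/
def regionU (ε b β σ : ℝ) : Set (ℝ × ℝ) := bump σ (halfLength ε + β) (b + β)

/-- `W` as a subset of the torus. -/
def setW (ε b σ : ℝ) : Set Torus := frame '' regionW ε b σ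

/-- `V` is one of the kinked vector fields on the torus. Tangent vectors are written by their
(stable, unstable) components in the orthonormal frame. -/
structure IsKinkedField (ε b β σ φ : ℝ) (V : Torus → ℝ × ℝ) : Prop where
  /-- `V` is `C^∞` (checked on the universal covering). -/
  smooth : ContDiff ℝ ∞ (fun z : ℝ × ℝ => V (frame z))
  /-- `V` has unit length. -/
  unit : ∀ p, (V p).1 ^ 2 + (V p).2 ^ 2 = 1
  /-- In `W`, `V` is tangent to the Gaussian-shaped curves. -/
  tangent : ∀ z ∈ regionW ε b σ,
    (V (frame z)).2 = deriv (gauss σ (level σ z)) z.1 * (V (frame z)).1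
  /-- The choice of orientation. -/
  base : V (frame (0, 0)) = (1, 0)
  /-- Outside `U'`, `V` forms the constant angle `φ` with the unstable direction (as a line
  field; either orientation is allowed). -/
  angle : ∀ p, p ∉ frame '' regionU' ε b β σ →
    V p = (Real.sin φ, Real.cos φ) ∨ V p = -(Real.sin φ, Real.cos φ)

/-- `c` is the lift to the universal covering of the integral curve of `V` with value `p` at
time `0`. -/
def IsLiftedIntegralCurve (V : Torus → ℝ × ℝ) (p : Torus) (c : ℝ → ℝ × ℝ) : Prop :=
  frame (c 0) = p ∧ ∀ t, HasDerivAt c (V (frame (c t))) t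

/-- The integral curve of `V` with value `p` at time `0`. For a `C^∞` field `V` on the torus it
exists for all times and is unique (the lift is unique up to a translation by the lattice of deck
transformations, which does not change the projection). -/
def integralCurve (V : Torus → ℝ × ℝ) (p : Torus) (t : ℝ) : Torus :=
  frame (Classical.epsilon (IsLiftedIntegralCurve V p) t)

/-- `Q_p`: the uniform distribution on the piece of the integral curve of `V` through `p` that
extends by arc length `ε` on both sides of `p`. As `V` has unit length, time is arc length. -/
def uniformAlong (V : Torus → ℝ × ℝ) (ε : ℝ) (p : Torus) : Measure Torus :=
  (ProbabilityTheory.cond (volume : Measure ℝ) (Set.Icc (-ε) ε)).map (integralCurve V p)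

/-- The transition probabilities `P(· | p) = Q_{f p}` of the perturbed Cat Map. -/
def transition (V : Torus → ℝ × ℝ) (ε : ℝ) (p : Torus) : Measure Torus :=
  uniformAlong V ε (catMap p)

/-- The push forward of measures by the perturbed dynamics, `A ↦ ∫ P(A | p) dν(p)`. -/
def pushForward (V : Torus → ℝ × ℝ) (ε : ℝ) (ν : Measure Torus) : Measure Torus :=
  ν.bind (transition V ε)

end KinkedCat

end

noncomputable section

namespace KinkedCat

open Set Filter Topology
open scoped NNReal

/-! ### The global flow of a bounded Lipschitz field -/

section Flow

variable {E : Type*} [NormedAddCommGroup E] [NormedSpace ℝ E] {v : E → E} {K : ℝ≥0}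

/-! The target is replaced by the open set `core`, the part of `W` with `|x|` above `X = coreRadius
σ`. The probability of lying in `W` after `N` steps is bounded below from every starting point of
the torus, and the integral of this bound over `W^c` is the claim.

The core is persistent (`core_subset_steer`). For `|x| > X` the Cat Map does not raise the Gaussian
level, so the image stays in `W`. If the image has `|x| ≤ X`, sliding along its Gaussian curve
brings it back beyond `X` in time less than `ε`, because `X + b < ε`.

Every point can be steered into the core. If the noise segment through `f p` has somewhere a nonzero
unstable component, its unstable extent is nonzero, the Cat Map stretches it, and density of
unstable lines makes some iterate meet the core (`exists_iterate_meets`). Otherwise the segment is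
horizontal. It then lies in `U'`, since `cos φ ≠ 0`, and its length `2ε` forces it onto the stable
axis, where it contains a point of the core (`mem_steer_of_snd_eq_zero`).

By persistence the open sets `steer V ε (core ε b σ) n` increase with `n`, so compactness yields one
`N` for all points. Continuity of the flow makes the hitting probability locally bounded below, and
compactness again yields one `η` (`exists_uniform_hit`). -/

theorem exists_solution_Ioo [CompleteSpace E] {L : ℝ≥0} (hv : LipschitzWith K v)
    (hL : ∀ z, ‖v z‖ ≤ L) (z : E) (T : ℝ) (hT : 0 < T) :
    ∃ c : ℝ → E, c 0 = z ∧ ∀ t ∈ Ioo (-T) T, HasDerivAt c (v (c t)) t := by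
  have hp : IsPicardLindelof (fun _ : ℝ => v) (tmin := -T) (tmax := T)
      ⟨0, by constructor <;> linarith⟩ z (L * ⟨T, hT.le⟩) 0 L K :=
    { lipschitzOnWith := fun t _ => hv.lipschitzOnWith
      continuousOn := fun x _ => continuousOn_const
      norm_le := fun t _ x _ => hL x
      mul_max_le := by simp; rfl }
  obtain ⟨c, h0, hc⟩ := hp.exists_eq_forall_mem_Icc_hasDerivWithinAt₀
  exact ⟨c, h0, fun t ht =>
    (hc t (Ioo_subset_Icc_self ht)).hasDerivAt (Icc_mem_nhds ht.1 ht.2)⟩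

theorem exists_global_solution [CompleteSpace E] {L : ℝ≥0} (hv : LipschitzWith K v)
    (hL : ∀ z, ‖v z‖ ≤ L) (z : E) :
    ∃ c : ℝ → E, c 0 = z ∧ ∀ t, HasDerivAt c (v (c t)) t := by
  choose! α h0 hα using exists_solution_Ioo hv hL z
  have key : ∀ S T t, 0 < S → S ≤ T → t ∈ Ioo (-S) S → α S t = α T t := by
    intro S T t hS hST ht
    refine ODE_solution_unique_of_mem_Ioo (v := fun _ => v) (s := fun _ => univ) (K := K)
      (a := -S) (b := S) (t₀ := 0) (fun _ _ => hv.lipschitzOnWith) ⟨by linarith, hS⟩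
      (fun s hs => ⟨hα S hS s hs, trivial⟩)
      (fun s hs => ⟨hα T (hS.trans_le hST) s ⟨by linarith [hs.1], by linarith [hs.2]⟩, trivial⟩)
      ?_ ht
    rw [h0 S hS, h0 T (hS.trans_le hST)]
  -- The window depends on `t`; near a given `t` the glued curve agrees with the single solution on
  -- the window of radius `|t| + 2`.
  refine ⟨fun t => α (|t| + 1) t, h0 _ (by positivity), fun t => ?_⟩
  have hpos : 0 < |t| + 2 := by positivity
  have hev : (fun s => α (|s| + 1) s) =ᶠ[𝓝 t] α (|t| + 2) := by
    have : ∀ᶠ s in 𝓝 t, |s| < |t| + 1 :=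
      continuous_abs.continuousAt.eventually_lt_const (by linarith)
    filter_upwards [this] with s hs
    have := abs_lt.1 (lt_add_one |s|)
    exact key _ _ _ (by positivity) (by linarith) this
  have ht := abs_lt.1 (show |t| < |t| + 2 by linarith)
  have := (hα (|t| + 2) hpos t ht).congr_of_eventuallyEq hev
  rwa [← hev.eq_of_nhds] at this

theorem solution_unique (hv : LipschitzWith K v) {c d : ℝ → E}
    (hc : ∀ t, HasDerivAt c (v (c t)) t) (hd : ∀ t, HasDerivAt d (v (d t)) t) (h : c 0 = d 0) :
    c = d :=
  ODE_solution_unique_univ (v := fun _ => v) (s := fun _ => univ) (t₀ := 0)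
    (fun _ => hv.lipschitzOnWith) (fun t => ⟨hc t, trivial⟩) (fun t => ⟨hd t, trivial⟩) h

theorem dist_solution_le (hv : LipschitzWith K v) {c d : ℝ → E}
    (hc : ∀ t, HasDerivAt c (v (c t)) t) (hd : ∀ t, HasDerivAt d (v (d t)) t) (t : ℝ) :
    dist (c t) (d t) ≤ dist (c 0) (d 0) * Real.exp (K * |t|) := by
  have forward : ∀ {w : E → E} {c d : ℝ → E}, LipschitzWith K w →
      (∀ t, HasDerivAt c (w (c t)) t) → (∀ t, HasDerivAt d (w (d t)) t) → ∀ t, 0 ≤ t →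
      dist (c t) (d t) ≤ dist (c 0) (d 0) * Real.exp (K * t) := by
    intro w c d hw hc hd t ht
    have := dist_le_of_trajectories_ODE (v := fun _ => w) (a := 0) (b := t) (fun _ => hw)
      (fun s _ => (hc s).continuousAt.continuousWithinAt)
      (fun s _ => (hc s).hasDerivWithinAt)
      (fun s _ => (hd s).continuousAt.continuousWithinAt)
      (fun s _ => (hd s).hasDerivWithinAt) le_rfl t ⟨ht, le_rfl⟩
    simpa using this
  rcases le_total 0 t with ht | ht
  · rw [abs_of_nonneg ht]
    exact forward hv hc hd t ht
  · rw [abs_of_nonpos ht]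
    -- Reversed curves solve the equation of `-v`, which has the same Lipschitz constant, so the
    -- forward Grönwall bound applies.
    have hr : ∀ {c : ℝ → E}, (∀ t, HasDerivAt c (v (c t)) t) →
        ∀ t, HasDerivAt (fun s => c (-s)) (-v (c (-t))) t := by
      intro c hc t
      simpa [Function.comp_def] using (hc (-t)).scomp t (hasDerivAt_neg t)
    have := forward (w := fun z => -v z) (c := fun s => c (-s)) (d := fun s => d (-s))
      hv.neg (hr hc) (hr hd) (-t) (by linarith)
    simpa using this

theorem exists_continuous_flow [CompleteSpace E] {L : ℝ≥0} (hv : LipschitzWith K v)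
    (hL : ∀ z, ‖v z‖ ≤ L) :
    ∃ F : E → ℝ → E, (∀ z, F z 0 = z) ∧ (∀ z t, HasDerivAt (F z) (v (F z t)) t) ∧
      Continuous fun q : E × ℝ => F q.1 q.2 := by
  choose F h0 hF using exists_global_solution hv hL
  refine ⟨F, h0, hF, continuous_iff_continuousAt.2 fun ⟨z₀, t₀⟩ => ?_⟩
  rw [ContinuousAt, tendsto_iff_dist_tendsto_zero]
  have hb : ∀ q : E × ℝ, dist (F q.1 q.2) (F z₀ t₀) ≤
      dist q.1 z₀ * Real.exp (K * |q.2|) + dist (F z₀ q.2) (F z₀ t₀) := by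
    intro q
    have := dist_solution_le hv (hF q.1) (hF z₀) q.2
    rw [h0, h0] at this
    exact (dist_triangle _ (F z₀ q.2) _).trans (by gcongr)
  refine squeeze_zero (fun _ => dist_nonneg) hb ?_
  have hc : Continuous (F z₀) := continuous_iff_continuousAt.2 fun t => (hF z₀ t).continuousAt
  have : Continuous fun q : E × ℝ =>
      dist q.1 z₀ * Real.exp (K * |q.2|) + dist (F z₀ q.2) (F z₀ t₀) := by fun_prop
  simpa using this.tendsto (z₀, t₀)

end Flow

/-! ### The covering map -/

theorem tau_sq : tau ^ 2 = 1 - tau := by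
  unfold tau
  nlinarith [Real.sq_sqrt (show (0 : ℝ) ≤ 5 by norm_num)]

theorem sqrt_five_bounds : 2.236 < √(5 : ℝ) ∧ √(5 : ℝ) < 2.237 :=
  ⟨Real.lt_sqrt_of_sq_lt (by norm_num), (Real.sqrt_lt' (by norm_num)).2 (by norm_num)⟩

theorem contr_eq : contr = 1 - tau := by unfold contr tau; ring

theorem expan_eq : expan = 2 + tau := by unfold expan tau; ring

/-- The norm `√(1 + τ²)` of the eigenvector `(1, τ)`. -/
def eigenNorm : ℝ := √(1 + tau ^ 2)

theorem eigenNorm_pos : 0 < eigenNorm := Real.sqrt_pos.2 (by positivity)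

theorem eigenNorm_sq : eigenNorm ^ 2 = 1 + tau ^ 2 := Real.sq_sqrt (by positivity)

/-- The change between standard and stable-unstable coordinates, which is an involution. -/
def rot (z : ℝ × ℝ) : ℝ × ℝ :=
  ((-tau * z.1 + z.2) / eigenNorm, (z.1 + tau * z.2) / eigenNorm)

theorem rot_rot (z : ℝ × ℝ) : rot (rot z) = z := by
  have h := eigenNorm_pos.ne'
  have h2 := eigenNorm_sq
  unfold rot
  ext
  · dsimp only
    field_simp
    linear_combination (-z.1) * h2
  · dsimp only
    field_simp
    linear_combination (-z.2) * h2

theorem continuous_rot : Continuous rot := by unfold rot; fun_prop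

theorem rot_add (z w : ℝ × ℝ) : rot (z + w) = rot z + rot w := by
  unfold rot; ext <;> simp <;> ring

/-- `rot` as a homeomorphism. -/
def rotHomeo : (ℝ × ℝ) ≃ₜ (ℝ × ℝ) where
  toFun := rot
  invFun := rot
  left_inv := rot_rot
  right_inv := rot_rot
  continuous_toFun := continuous_rot
  continuous_invFun := continuous_rot

theorem frame_eq (z : ℝ × ℝ) : frame z = (((rot z).1 : UnitAddCircle), ((rot z).2 : UnitAddCircle)) := rfl

theorem isOpenQuotientMap_frame : IsOpenQuotientMap frame := by
  have h : IsOpenQuotientMap (fun x : ℝ => (x : UnitAddCircle)) :=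
    QuotientAddGroup.isOpenQuotientMap_mk
  exact (h.prodMap h).comp rotHomeo.isOpenQuotientMap

theorem continuous_frame : Continuous frame := isOpenQuotientMap_frame.continuous

theorem frame_surjective : Function.Surjective frame := isOpenQuotientMap_frame.surjective

theorem frame_add (z w : ℝ × ℝ) : frame (z + w) = frame z + frame w := by
  simp [frame_eq, rot_add]

/-- The lattice of deck transformations in stable-unstable coordinates. -/
def deck (m n : ℤ) : ℝ × ℝ := rot (m, n)

theorem frame_deck (m n : ℤ) : frame (deck m n) = 0 := by
  rw [frame_eq, deck, rot_rot]
  ext <;> simp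

theorem frame_add_deck (z : ℝ × ℝ) (m n : ℤ) : frame (z + deck m n) = frame z := by
  rw [frame_add, frame_deck, add_zero]

theorem frame_eq_iff {z w : ℝ × ℝ} : frame z = frame w ↔ ∃ m n : ℤ, w = z + deck m n := by
  constructor
  · intro h
    rw [frame_eq, frame_eq, Prod.mk.injEq] at h
    obtain ⟨m, hm⟩ := AddCircle.coe_eq_zero_iff (1 : ℝ) |>.1
      (show (((rot w).1 - (rot z).1 : ℝ) : UnitAddCircle) = 0 by
        rw [AddCircle.coe_sub, h.1, sub_self])
    obtain ⟨n, hn⟩ := AddCircle.coe_eq_zero_iff (1 : ℝ) |>.1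
      (show (((rot w).2 - (rot z).2 : ℝ) : UnitAddCircle) = 0 by
        rw [AddCircle.coe_sub, h.2, sub_self])
    refine ⟨m, n, ?_⟩
    have : rot w = rot z + ((m : ℝ), (n : ℝ)) := by
      ext
      · simp at hm ⊢; linarith
      · simp at hn ⊢; linarith
    rw [← rot_rot w, this, rot_add, rot_rot, deck]
  · rintro ⟨m, n, rfl⟩
    rw [frame_add_deck]

theorem catMap_frame (z : ℝ × ℝ) : catMap (frame z) = frame (contr * z.1, expan * z.2) := by
  have h : catMap (frame z) =
      (((2 * (rot z).1 + (rot z).2 : ℝ) : UnitAddCircle), (((rot z).1 + (rot z).2 : ℝ) : UnitAddCircle)) := by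
    rw [frame_eq, catMap]
    ext <;> simp [two_mul, two_smul]
  rw [h, frame_eq, contr_eq, expan_eq]
  have e := eigenNorm_pos.ne'
  congr 2
  · unfold rot
    dsimp only
    field_simp
    linear_combination (-z.1) * tau_sq
  · unfold rot
    dsimp only
    field_simp
    linear_combination (-z.2) * tau_sq 

theorem continuous_catMap : Continuous catMap := by unfold catMap; fun_prop

/-! ### The flow of a smooth unit field on the torus -/

section TorusFlow

variable {V : Torus → ℝ × ℝ}

/-- The derivative of the lifted field is invariant under deck transformations, so its norm descends
to a continuous function on the compact torus. -/
theorem exists_lipschitzWith (hs : ContDiff ℝ ∞ (fun z : ℝ × ℝ => V (frame z))) :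
    ∃ K : ℝ≥0, LipschitzWith K (fun z : ℝ × ℝ => V (frame z)) := by
  set v : ℝ × ℝ → ℝ × ℝ := fun z => V (frame z) with hvdef
  have hper : ∀ z w, frame z = frame w → fderiv ℝ v z = fderiv ℝ v w := by
    intro z w h
    obtain ⟨m, n, rfl⟩ := frame_eq_iff.1 h
    rw [← fderiv_comp_add_right]
    congr 1
    funext x
    simp only [hvdef, frame_add_deck]
  let G : Torus → ℝ := fun p => ‖fderiv ℝ v (Function.surjInv frame_surjective p)‖
  have hG : ∀ z, G (frame z) = ‖fderiv ℝ v z‖ := fun z => by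
    simp only [G]
    rw [hper _ z (Function.surjInv_eq frame_surjective _)]
  have hGc : Continuous G := by
    rw [← isOpenQuotientMap_frame.continuous_comp_iff]
    have : G ∘ frame = fun z => ‖fderiv ℝ v z‖ := funext hG
    rw [this]
    exact (hs.continuous_fderiv (by simp)).norm
  obtain ⟨C, hC⟩ := isCompact_univ.bddAbove_image hGc.continuousOn
  have hC' : ∀ z, ‖fderiv ℝ v z‖ ≤ C := fun z => hG z ▸ hC ⟨frame z, trivial, rfl⟩
  have hC0 : 0 ≤ C := (norm_nonneg _).trans (hC' 0)
  exact ⟨⟨C, hC0⟩, lipschitzWith_of_nnnorm_fderiv_le (hs.differentiable (by simp)) fun z => hC' z⟩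

/-- The flow of a smooth unit field lifts to a flow of the plane, and is continuous. -/
theorem exists_lifted_flow (hs : ContDiff ℝ ∞ (fun z : ℝ × ℝ => V (frame z)))
    (hu : ∀ p, (V p).1 ^ 2 + (V p).2 ^ 2 = 1) :
    ∃ F : ℝ × ℝ → ℝ → ℝ × ℝ, (∀ z, F z 0 = z) ∧
      (∀ z t, HasDerivAt (F z) (V (frame (F z t))) t) ∧
      (∀ z t, integralCurve V (frame z) t = frame (F z t)) ∧
      Continuous fun q : Torus × ℝ => integralCurve V q.1 q.2 := by
  obtain ⟨K, hK⟩ := exists_lipschitzWith hs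
  have hL : ∀ z, ‖V (frame z)‖ ≤ (1 : ℝ≥0) := fun z => max_le
    (abs_le_one_iff_mul_self_le_one.2 (by nlinarith [hu (frame z), sq_nonneg (V (frame z)).2]))
    (abs_le_one_iff_mul_self_le_one.2 (by nlinarith [hu (frame z), sq_nonneg (V (frame z)).1]))
  obtain ⟨F, h0, hF, hc⟩ := exists_continuous_flow hK hL
  have hI : ∀ z t, integralCurve V (frame z) t = frame (F z t) := by
    intro z t
    have hex : ∃ c, IsLiftedIntegralCurve V (frame z) c := ⟨F z, by rw [h0], hF z⟩
    obtain ⟨e0, e1⟩ := Classical.epsilon_spec hex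
    unfold integralCurve
    set c := Classical.epsilon (IsLiftedIntegralCurve V (frame z))
    obtain ⟨m, n, hmn⟩ := frame_eq_iff.1 e0
    -- The lift picked by `Classical.epsilon` may start at another point of the fibre; a deck
    -- translation carries it to `F z`.
    have : (fun s => c s + deck m n) = F z := by
      refine solution_unique hK (fun s => ?_) (hF z) (by rw [h0, hmn])
      simpa only [frame_add_deck] using (e1 s).add_const (deck m n)
    rw [← this, frame_add_deck]
  refine ⟨F, h0, hF, hI, ?_⟩
  rw [← (isOpenQuotientMap_frame.prodMap (IsOpenQuotientMap.id (X := ℝ))).continuous_comp_iff]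
  have : (fun q : Torus × ℝ => integralCurve V q.1 q.2) ∘ Prod.map frame id =
      fun q : (ℝ × ℝ) × ℝ => frame (F q.1 q.2) := funext fun q => hI q.1 q.2
  rw [this]
  exact continuous_frame.comp hc

end TorusFlow

/-! ### Lower bounds for the iterated transition probabilities -/

section Reach

variable {V : Torus → ℝ × ℝ} {ε : ℝ}

theorem measurable_transition (hc : Continuous fun q : Torus × ℝ => integralCurve V q.1 q.2) :
    Measurable (transition V ε) := by
  refine Measure.measurable_of_measurable_coe _ fun s hs => ?_
  have hc' : Continuous fun q : Torus × ℝ => integralCurve V (catMap q.1) q.2 :=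
    hc.comp ((continuous_catMap.comp continuous_fst).prodMk continuous_snd)
  have h : ∀ p, transition V ε p s = ProbabilityTheory.cond (volume : Measure ℝ) (Icc (-ε) ε)
      (Prod.mk p ⁻¹' ((fun q : Torus × ℝ => integralCurve V (catMap q.1) q.2) ⁻¹' s)) := fun p => by
    unfold transition uniformAlong
    exact Measure.map_apply (hc'.comp (Continuous.prodMk_right p)).measurable hs
  simp_rw [h]
  exact measurable_measure_prodMk_left (hc'.measurable hs)

/-- The probability, started at `p`, to lie in `A` after `n` steps. -/
def hitProb (V : Torus → ℝ × ℝ) (ε : ℝ) (A : Set Torus) : ℕ → Torus → ENNReal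
  | 0 => A.indicator 1
  | n + 1 => fun p => ∫⁻ q, hitProb V ε A n q ∂(transition V ε p)

theorem measurable_hitProb (hc : Continuous fun q : Torus × ℝ => integralCurve V q.1 q.2)
    {A : Set Torus} (hA : MeasurableSet A) (n : ℕ) : Measurable (hitProb V ε A n) := by
  induction n with
  | zero => exact measurable_one.indicator hA
  | succ n ih => exact (Measure.measurable_lintegral ih).comp (measurable_transition hc)

theorem pushForward_iterate_apply
    (hc : Continuous fun q : Torus × ℝ => integralCurve V q.1 q.2)
    {A : Set Torus} (hA : MeasurableSet A) (n : ℕ) (ν : Measure Torus) :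
    ((pushForward V ε)^[n] ν) A = ∫⁻ p, hitProb V ε A n p ∂ν := by
  induction n generalizing ν with
  | zero => simp [hitProb, lintegral_indicator_one hA]
  | succ n ih =>
    rw [Function.iterate_succ_apply, ih, pushForward,
      Measure.lintegral_bind (measurable_transition hc).aemeasurable
        (measurable_hitProb hc hA n).aemeasurable]
    rfl

/-- This is why `steer` uses the open time interval: times near an interior steering time carry
positive probability. -/
theorem cond_Icc_pos {t : ℝ} (ht : t ∈ Ioo (-ε) ε) {S : Set ℝ} (hS : S ∈ 𝓝 t) :
    0 < ProbabilityTheory.cond (volume : Measure ℝ) (Icc (-ε) ε) S := by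
  have hpos : 0 < volume (Icc (-ε) ε ∩ S) :=
    Measure.measure_pos_of_mem_nhds _ (inter_mem (Icc_mem_nhds ht.1 ht.2) hS)
  rw [ProbabilityTheory.cond_apply measurableSet_Icc]
  exact ENNReal.mul_pos (by simp) hpos.ne'

/-- The points that can be steered into `A` by exactly `n` steps. -/
def steer (V : Torus → ℝ × ℝ) (ε : ℝ) (A : Set Torus) : ℕ → Set Torus
  | 0 => A
  | n + 1 => {p | ∃ t ∈ Ioo (-ε) ε, integralCurve V (catMap p) t ∈ steer V ε A n}

theorem isOpen_steer (hc : Continuous fun q : Torus × ℝ => integralCurve V q.1 q.2)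
    {A : Set Torus} (hA : IsOpen A) (n : ℕ) : IsOpen (steer V ε A n) := by
  induction n with
  | zero => exact hA
  | succ n ih =>
    have : steer V ε A (n + 1) =
        ⋃ t ∈ Ioo (-ε) ε, (fun p => integralCurve V (catMap p) t) ⁻¹' steer V ε A n := by
      ext p; simp [steer]
    rw [this]
    refine isOpen_biUnion fun t _ => ih.preimage ?_
    exact hc.comp (continuous_catMap.prodMk continuous_const)

theorem steer_mono {A : Set Torus} (hA : A ⊆ steer V ε A 1) : Monotone (steer V ε A) := by
  refine monotone_nat_of_le_succ fun n => ?_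
  induction n with
  | zero => exact hA
  | succ n ih => exact fun p ⟨t, ht, h⟩ => ⟨t, ht, ih h⟩

theorem exists_le_hitProb (hc : Continuous fun q : Torus × ℝ => integralCurve V q.1 q.2)
    {A B : Set Torus} (hA : IsOpen A) (hAB : A ⊆ B) (hB : MeasurableSet B) (n : ℕ)
    {p : Torus} (hp : p ∈ steer V ε A n) :
    ∃ η : ℝ≥0, 0 < η ∧ ∀ᶠ q in 𝓝 p, (η : ENNReal) ≤ hitProb V ε B n q := by
  induction n generalizing p with
  | zero =>
    refine ⟨1, one_pos, ?_⟩
    filter_upwards [hA.mem_nhds hp] with q hq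
    simp [hitProb, hAB hq]
  | succ n ih =>
    obtain ⟨t, ht, h⟩ := hp
    obtain ⟨η, hη, hev⟩ := ih h
    have hc' : Continuous fun q : Torus × ℝ => integralCurve V (catMap q.1) q.2 :=
      hc.comp ((continuous_catMap.comp continuous_fst).prodMk continuous_snd)
    -- Joint continuity gives a product neighbourhood: all starting points near `p` and all times in
    -- `S` land where the bound `η` holds.
    have hev2 := (hc'.tendsto (p, t)).eventually hev
    rw [nhds_prod_eq, eventually_prod_iff] at hev2
    obtain ⟨P, hP, S, hS, hPS⟩ := hev2
    set m := ProbabilityTheory.cond (volume : Measure ℝ) (Icc (-ε) ε)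
    have hmS : 0 < m {s | S s} := cond_Icc_pos ht hS
    obtain ⟨δ, hδ0, hδ⟩ := ENNReal.lt_iff_exists_nnreal_btwn.1 hmS
    refine ⟨η * δ, mul_pos hη (by exact_mod_cast hδ0), ?_⟩
    filter_upwards [hP] with q hq
    have hq' : Measurable (integralCurve V (catMap q)) :=
      (hc.comp (Continuous.prodMk_right (catMap q))).measurable
    calc ((η * δ : ℝ≥0) : ENNReal) ≤ η * m {s | S s} := by
          rw [ENNReal.coe_mul]; gcongr
      _ ≤ η * m {s | (η : ENNReal) ≤ hitProb V ε B n (integralCurve V (catMap q) s)} := by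
          gcongr
          exact fun hs => hPS hq hs
      _ ≤ ∫⁻ s, hitProb V ε B n (integralCurve V (catMap q) s) ∂m :=
          mul_meas_ge_le_lintegral₀ ((measurable_hitProb hc hB n).comp hq').aemeasurable _
      _ = hitProb V ε B (n + 1) q := (lintegral_map (measurable_hitProb hc hB n) hq').symm

/-- If `A` can be returned to in one step and reached from everywhere, then a larger set `B` is hit
with a probability bounded below. -/
theorem exists_uniform_hit (hc : Continuous fun q : Torus × ℝ => integralCurve V q.1 q.2)
    {A B : Set Torus} (hA : IsOpen A) (hAB : A ⊆ B) (hB : MeasurableSet B)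
    (hret : A ⊆ steer V ε A 1) (hreach : ∀ p, ∃ n, p ∈ steer V ε A n) :
    ∃ (N : ℕ) (η : ℝ≥0), 0 < η ∧ ∀ p, (η : ENNReal) ≤ hitProb V ε B N p := by
  have hmono := steer_mono hret
  -- The sets are nested by `hret`, so a finite subcover reduces to its largest member.
  obtain ⟨N, hN⟩ : ∃ N, univ ⊆ steer V ε A N :=
    isCompact_univ.elim_directed_cover (steer V ε A) (fun n => isOpen_steer hc hA n)
      (fun p _ => mem_iUnion.2 (hreach p)) (hmono.directed_le)
  choose η hη hev using fun p => exists_le_hitProb (ε := ε) hc hA hAB hB N (hN (mem_univ p))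
  obtain ⟨t, ht⟩ := isCompact_univ.elim_nhds_subcover
    (fun p => {q | (η p : ENNReal) ≤ hitProb V ε B N q}) (fun p _ => hev p)
  have htn : t.Nonempty := by
    obtain ⟨p, hp, -⟩ := mem_iUnion₂.1 (ht.2 (mem_univ (0 : Torus)))
    exact ⟨p, hp⟩
  refine ⟨N, t.inf' htn η, (Finset.lt_inf'_iff htn).2 fun p _ => hη p, fun p => ?_⟩
  obtain ⟨q, hq, hpq⟩ := mem_iUnion₂.1 (ht.2 (mem_univ p))
  exact (ENNReal.coe_le_coe.2 (Finset.inf'_le η hq)).trans hpq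

end Reach

/-! ### Density of unstable lines -/

theorem tau_bounds : 0.618 < tau ∧ tau < 0.6185 := by
  have := sqrt_five_bounds
  unfold tau
  constructor <;> linarith [this.1, this.2]

theorem contr_pos : 0 < contr := by rw [contr_eq]; linarith [tau_bounds.2]

theorem contr_lt_one : contr < 1 := by rw [contr_eq]; linarith [tau_bounds.1]

theorem one_lt_expan : 1 < expan := by rw [expan_eq]; linarith [tau_bounds.1]

theorem irrational_tau : Irrational tau := by
  have h : Irrational √(5 : ℝ) := by
    simpa using Nat.Prime.irrational_sqrt (p := 5) (by norm_num)
  have := (h.sub_intCast 1).div_intCast (m := 2) (by norm_num)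
  simpa [tau] using this

/-- Up to the factor `eigenNorm`, the stable coordinates of lattice points form the group `ℤ + ℤ τ`,
dense because `τ` is irrational. -/
theorem exists_deck_fst_near (x : ℝ) {r : ℝ} (hr : 0 < r) :
    ∃ m n : ℤ, |(deck m n).1 - x| < r := by
  have hd : Dense (AddSubgroup.closure {tau, 1} : Set ℝ) := by
    rw [dense_addSubgroupClosure_pair_iff, div_one]
    exact irrational_tau
  obtain ⟨z, hz, hzr⟩ := hd.exists_dist_lt (eigenNorm * x) (mul_pos eigenNorm_pos hr)
  obtain ⟨m, n, rfl⟩ := AddSubgroup.mem_closure_pair.1 hz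
  refine ⟨-m, n, ?_⟩
  have h : (deck (-m) n).1 - x = -((eigenNorm * x - (m • tau + n • 1)) / eigenNorm) := by
    have := eigenNorm_pos.ne'
    simp only [deck, rot, zsmul_eq_mul]
    push_cast
    field_simp
    ring
  rw [h, abs_neg, abs_div, abs_of_pos eigenNorm_pos, div_lt_iff₀ eigenNorm_pos, mul_comm r]
  simpa [Real.dist_eq] using hzr

theorem exists_unstable_translate {O : Set Torus} (hO : IsOpen O) (hne : O.Nonempty)
    (p : Torus) : ∃ y : ℝ, p + frame (0, y) ∈ O := by
  obtain ⟨q, hq⟩ := hne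
  obtain ⟨w, rfl⟩ := frame_surjective q
  obtain ⟨z, rfl⟩ := frame_surjective p
  obtain ⟨r, hr, hball⟩ := Metric.isOpen_iff.1 (hO.preimage continuous_frame) w hq
  obtain ⟨m, n, hmn⟩ := exists_deck_fst_near (w.1 - z.1) hr
  refine ⟨w.2 - z.2 - (deck m n).2, ?_⟩
  rw [← frame_add, ← frame_add_deck _ m n]
  apply hball
  rw [Metric.mem_ball, Prod.dist_eq, max_lt_iff]
  constructor
  · have h : z.1 + 0 + (deck m n).1 - w.1 = (deck m n).1 - (w.1 - z.1) := by ring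
    rw [← h] at hmn
    exact hmn
  · have h : z.2 + (w.2 - z.2 - (deck m n).2) + (deck m n).2 - w.2 = 0 := by ring
    change |z.2 + (w.2 - z.2 - (deck m n).2) + (deck m n).2 - w.2| < r
    rwa [h, abs_zero]

/-- Compactness makes the density of unstable lines quantitative: the length `L` does not depend on
the base point. -/
theorem exists_bounded_unstable_translate {O : Set Torus} (hO : IsOpen O) (hne : O.Nonempty) :
    ∃ L : ℝ, ∀ p : Torus, ∃ y : ℝ, |y| ≤ L ∧ p + frame (0, y) ∈ O := by
  let S : ℕ → Set Torus := fun n => ⋃ y ∈ {y : ℝ | |y| ≤ n}, (fun p => p + frame (0, y)) ⁻¹' O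
  have hS : ∀ n, IsOpen (S n) := fun n =>
    isOpen_biUnion fun y _ => hO.preimage (by fun_prop)
  have hmono : Monotone S := fun m n h => biUnion_subset_biUnion_left fun y (hy : |y| ≤ m) =>
    hy.trans (by exact_mod_cast h)
  obtain ⟨N, hN⟩ := isCompact_univ.elim_directed_cover S hS (fun p _ => by
    obtain ⟨y, hy⟩ := exists_unstable_translate hO hne p
    obtain ⟨n, hn⟩ := exists_nat_ge |y|
    exact mem_iUnion.2 ⟨n, mem_iUnion₂.2 ⟨y, hn, hy⟩⟩) hmono.directed_le
  refine ⟨N, fun p => ?_⟩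
  obtain ⟨y, hy, h⟩ := mem_iUnion₂.1 (hN (mem_univ p))
  exact ⟨y, hy, h⟩

/-- A curve with a nonconstant unstable coordinate is stretched by the Cat Map until it meets a
given open set. -/
theorem exists_iterate_meets {O : Set Torus} (hO : IsOpen O) (hne : O.Nonempty)
    {c : ℝ → ℝ × ℝ} (hc : Continuous c) {t₁ t₂ : ℝ} (h : (c t₁).2 ≠ (c t₂).2) :
    ∃ (n : ℕ) (t : ℝ), t ∈ uIcc t₁ t₂ ∧
      frame (contr ^ n * (c t).1, expan ^ n * (c t).2) ∈ O := by
  wlog hlt : (c t₁).2 < (c t₂).2 generalizing t₁ t₂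
  · rw [uIcc_comm]
    exact this h.symm (lt_of_le_of_ne (not_lt.1 hlt) h.symm)
  obtain ⟨q, hq⟩ := hne
  obtain ⟨w, rfl⟩ := frame_surjective q
  obtain ⟨r, hr, hball⟩ := Metric.isOpen_iff.1 (hO.preimage continuous_frame) w hq
  -- Half the radius is kept in reserve for the stable coordinate of the iterated curve, which tends
  -- to `0` uniformly.
  obtain ⟨L, hL⟩ := exists_bounded_unstable_translate
    (isOpenQuotientMap_frame.isOpenMap _ (Metric.isOpen_ball (x := w) (ε := r / 2)))
    ⟨frame w, mem_image_of_mem _ (Metric.mem_ball_self (half_pos hr))⟩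
  obtain ⟨M, hM⟩ := isCompact_uIcc.bddAbove_image
    (f := fun t => |(c t).1|) (K := uIcc t₁ t₂) (by fun_prop)
  have hlim1 : ∀ᶠ n : ℕ in atTop, contr ^ n * M < r / 2 := by
    have : Tendsto (fun n : ℕ => contr ^ n * M) atTop (𝓝 (0 * M)) :=
      (tendsto_pow_atTop_nhds_zero_of_lt_one contr_pos.le contr_lt_one).mul_const M
    rw [zero_mul] at this
    exact this.eventually_lt_const (half_pos hr)
  have hlim2 : ∀ᶠ n : ℕ in atTop, 2 * L ≤ expan ^ n * ((c t₂).2 - (c t₁).2) :=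
    ((tendsto_pow_atTop_atTop_of_one_lt one_lt_expan).atTop_mul_const
      (sub_pos.2 hlt)).eventually_ge_atTop _
  obtain ⟨n, hn1, hn2⟩ := (hlim1.and hlim2).exists
  -- The unstable extent is at least `2 * L`, so a shift by at most `L` from its midpoint is
  -- attained on the curve.
  obtain ⟨y, hy, u, hu, huy⟩ := hL (frame (0, expan ^ n * ((c t₁).2 + (c t₂).2) / 2))
  rw [← frame_add] at huy
  have hpos : 0 < expan ^ n := pow_pos (zero_lt_one.trans one_lt_expan) n
  set s := expan ^ n * ((c t₁).2 + (c t₂).2) / 2 + y with hs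
  have hy' := abs_le.1 hy
  have hmem : s ∈ uIcc (expan ^ n * (c t₁).2) (expan ^ n * (c t₂).2) := by
    rw [uIcc_of_le (by gcongr)]
    constructor <;> rw [hs] <;> nlinarith [hy'.1, hy'.2]
  obtain ⟨t, ht, hts⟩ := intermediate_value_uIcc (f := fun t => expan ^ n * (c t).2)
    (Continuous.continuousOn (by fun_prop)) hmem
  refine ⟨n, t, ht, ?_⟩
  have hMt : |(c t).1| ≤ M := hM ⟨t, ht, rfl⟩
  have hsplit : ((contr ^ n * (c t).1, expan ^ n * (c t).2) : ℝ × ℝ) =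
      (0, expan ^ n * ((c t₁).2 + (c t₂).2) / 2) + (0, y) + (contr ^ n * (c t).1, 0) := by
    ext
    · simp
    · simpa [hs] using hts
  rw [hsplit, frame_add, ← huy, ← frame_add]
  apply hball
  rw [Metric.mem_ball]
  have h1 : dist (u + (contr ^ n * (c t).1, 0)) u < r / 2 := by
    rw [dist_eq_norm, add_sub_cancel_left, Prod.norm_def]
    simp only [norm_zero, Real.norm_eq_abs, abs_mul, abs_of_pos (pow_pos contr_pos n)]
    rw [max_eq_left (by have := contr_pos; positivity)]
    exact (mul_le_mul_of_nonneg_left hMt (pow_pos contr_pos n).le).trans_lt hn1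
  have h2 : dist u w < r / 2 := hu
  linarith [dist_triangle (u + (contr ^ n * (c t).1, 0)) u w]

theorem catMap_iterate_frame (n : ℕ) (z : ℝ × ℝ) :
    catMap^[n] (frame z) = frame (contr ^ n * z.1, expan ^ n * z.2) := by
  induction n with
  | zero => simp
  | succ n ih =>
    rw [Function.iterate_succ_apply', ih, catMap_frame]
    congr 2 <;> ring

theorem mem_steer_of_iterate {V : Torus → ℝ × ℝ} {ε : ℝ} {A : Set Torus} (hε : 0 < ε)
    (h0 : ∀ p, integralCurve V p 0 = p) {n : ℕ} {p : Torus} (h : catMap^[n] p ∈ A) :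
    p ∈ steer V ε A n := by
  induction n generalizing p with
  | zero => exact h
  | succ n ih =>
    refine ⟨0, ⟨by linarith, hε⟩, ?_⟩
    rw [h0]
    exact ih (by rwa [← Function.iterate_succ_apply])

/-! ### Sliding along the Gaussian-shaped curves -/

theorem gauss_level (σ : ℝ) (z : ℝ × ℝ) : gauss σ (level σ z) z.1 = z.2 := by
  unfold gauss level
  rw [mul_assoc, ← Real.exp_add, neg_div, add_neg_cancel, Real.exp_zero, mul_one]

theorem hasDerivAt_gauss (σ K x : ℝ) :
    HasDerivAt (gauss σ K) (-(x * gauss σ K x / σ ^ 2)) x := by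
  have h : HasDerivAt (fun x : ℝ => -x ^ 2 / (2 * σ ^ 2)) (-(2 * x) / (2 * σ ^ 2)) x := by
    simpa using ((hasDerivAt_pow 2 x).neg).div_const (2 * σ ^ 2)
  refine (h.exp.const_mul K).congr_deriv ?_
  have : -(2 * x) / (2 * σ ^ 2) = -(x / σ ^ 2) := by
    rw [neg_div, mul_div_mul_left _ _ two_ne_zero]
  rw [this, gauss]
  ring

theorem gauss_le {σ K : ℝ} (hK : 0 ≤ K) (x : ℝ) : gauss σ K x ≤ K :=
  mul_le_of_le_one_right hK (Real.exp_le_one_iff.2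
    (div_nonpos_of_nonpos_of_nonneg (neg_nonpos.2 (sq_nonneg x)) (by positivity)))

/-- In the coordinates `(x, level)` the curved region is a rectangle, and sliding along the curves
keeps the second coordinate fixed. -/
theorem mem_bump_iff {σ r h : ℝ} {z : ℝ × ℝ} :
    z ∈ bump σ r h ↔ |z.1| < r ∧ |level σ z| < h := by
  have e : gauss σ h z.1 = h / Real.exp (z.1 ^ 2 / (2 * σ ^ 2)) := by
    rw [gauss, neg_div, Real.exp_neg]; rfl
  unfold bump
  rw [mem_ofPred_eq, e, lt_div_iff₀ (Real.exp_pos _), level, abs_mul, Real.abs_exp]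

theorem continuous_level (σ : ℝ) : Continuous (level σ) := by unfold level; fun_prop

theorem isOpen_bump (σ r h : ℝ) : IsOpen (bump σ r h) := by
  have : bump σ r h = {z | |z.1| < r} ∩ {z | |level σ z| < h} := by
    ext z; exact mem_bump_iff
  rw [this]
  exact (isOpen_lt (by fun_prop) continuous_const).inter
    (isOpen_lt (continuous_level σ).abs continuous_const)

theorem smul_mem_bump {σ r h : ℝ} (hh : 0 ≤ h) {z : ℝ × ℝ} (hz : z ∈ bump σ r h) {s : ℝ}
    (hs : s ∈ Icc (0 : ℝ) 1) : s • z ∈ bump σ r h := by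
  obtain ⟨h1, h2⟩ := hz
  have e1 : |s * z.1| ≤ |z.1| := by
    rw [abs_mul, abs_of_nonneg hs.1]; exact mul_le_of_le_one_left (abs_nonneg _) hs.2
  have e2 : |s * z.2| ≤ |z.2| := by
    rw [abs_mul, abs_of_nonneg hs.1]; exact mul_le_of_le_one_left (abs_nonneg _) hs.2
  refine ⟨e1.trans_lt h1, (e2.trans_lt h2).trans_le ?_⟩
  have := sq_le_sq.2 e1
  simp only [gauss, Prod.smul_fst, smul_eq_mul]
  gcongr

/-- A unit speed curve, tangent to the Gaussian-shaped curves and moving to the right in the region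
bounded by `x = ±a` and `y = ± b exp (-x² / (2σ²))`, moves beyond `X < a` before the time `ε`
if it starts with `0 ≤ x ≤ X` and if `X + b < ε`. -/
theorem exists_slide_right {σ a b X ε : ℝ} {x y v₁ v₂ : ℝ → ℝ} (hXa : X < a)
    (hXb : X + b < ε)
    (hx : ∀ t, HasDerivAt x (v₁ t) t) (hy : ∀ t, HasDerivAt y (v₂ t) t)
    (hunit : ∀ t, v₁ t ^ 2 + v₂ t ^ 2 = 1)
    (hpos : ∀ t, (x t, y t) ∈ bump σ a b → 0 < v₁ t)
    (htan : ∀ t, (x t, y t) ∈ bump σ a b → v₂ t = -(x t * y t / σ ^ 2) * v₁ t)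
    (h0 : (x 0, y 0) ∈ bump σ a b) (hx0 : 0 ≤ x 0) (hx0X : x 0 ≤ X) :
    ∃ t ∈ Ico 0 ε, (x t, y t) ∈ bump σ a b ∧ X < x t := by
  by_contra! H
  have hxc : Continuous x := continuous_iff_continuousAt.2 fun t => (hx t).continuousAt
  have hyc : Continuous y := continuous_iff_continuousAt.2 fun t => (hy t).continuousAt
  have hcc : Continuous fun t => (x t, y t) := hxc.prodMk hyc
  have hlc : Continuous fun t => level σ (x t, y t) := (continuous_level σ).comp hcc
  have hl0 := (mem_bump_iff.1 h0).2
  have hb : 0 < b := (abs_nonneg _).trans_lt hl0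
  have hld : ∀ t, (x t, y t) ∈ bump σ a b →
      HasDerivAt (fun t => level σ (x t, y t)) 0 t := by
    intro t ht
    have h1 : HasDerivAt (fun t => x t ^ 2 / (2 * σ ^ 2)) (2 * x t * v₁ t / (2 * σ ^ 2)) t := by
      simpa using ((hx t).pow 2).div_const (2 * σ ^ 2)
    refine ((hy t).mul h1.exp).congr_deriv ?_
    have : 2 * x t * v₁ t / (2 * σ ^ 2) = x t * v₁ t / σ ^ 2 := by
      rw [mul_assoc, mul_div_mul_left _ _ two_ne_zero]
    rw [htan t ht, this]
    ring
  -- Under the negated claim, these conditions persist up to time `X + b`: the set is closed, and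
  -- inside the bump `x` increases while the level is constant.
  let s : Set ℝ := {t | (0 ≤ x t ∧ x t ≤ X) ∧ level σ (x t, y t) = level σ (x 0, y 0)}
  have hsW : ∀ t ∈ s, (x t, y t) ∈ bump σ a b := by
    rintro t ⟨⟨h1, h2⟩, h3⟩
    refine mem_bump_iff.2 ⟨?_, by rw [h3]; exact hl0⟩
    rw [abs_of_nonneg h1]
    exact h2.trans_lt hXa
  have hsc : IsClosed s :=
    ((isClosed_le continuous_const hxc).inter (isClosed_le hxc continuous_const)).inter
      (isClosed_eq hlc continuous_const)
  have hT : 0 ≤ X + b := by linarith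
  have hall : Icc 0 (X + b) ⊆ s := by
    refine IsClosed.Icc_subset_of_forall_exists_gt (hsc.inter isClosed_Icc)
      ⟨⟨hx0, hx0X⟩, rfl⟩ ?_
    rintro t ⟨hts, ht0, htT⟩ u hu
    obtain ⟨δ, hδ, hball⟩ := Metric.isOpen_iff.1 ((isOpen_bump σ a b).preimage hcc) t (hsW t hts)
    set r := min (t + δ / 2) (min u (X + b)) with hr
    have htr : t < r := lt_min (by linarith) (lt_min hu htT)
    have hr1 : r ≤ t + δ / 2 := min_le_left _ _
    have hr2 : r ≤ u := (min_le_right _ _).trans (min_le_left _ _)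
    have hr3 : r ≤ X + b := (min_le_right _ _).trans (min_le_right _ _)
    have hW : ∀ q ∈ Icc t r, (x q, y q) ∈ bump σ a b := fun q hq => hball (by
      rw [Metric.mem_ball, Real.dist_eq, abs_lt]
      constructor <;> linarith [hq.1, hq.2])
    have hlr : level σ (x r, y r) = level σ (x t, y t) :=
      constant_of_has_deriv_right_zero hlc.continuousOn
        (fun q hq => (hld q (hW q (Ico_subset_Icc_self hq))).hasDerivWithinAt) r ⟨htr.le, le_rfl⟩
    have hmono : MonotoneOn x (Icc t r) := by
      refine monotoneOn_of_deriv_nonneg (convex_Icc t r) hxc.continuousOn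
        (fun q _ => (hx q).differentiableAt.differentiableWithinAt) fun q hq => ?_
      rw [interior_Icc] at hq
      rw [(hx q).deriv]
      exact (hpos q (hW q (Ioo_subset_Icc_self hq))).le
    have hrt := hmono ⟨le_rfl, htr.le⟩ ⟨htr.le, le_rfl⟩ htr.le
    exact ⟨r, ⟨⟨hts.1.1.trans hrt, H r ⟨ht0.trans htr.le, by linarith⟩ (hW r ⟨htr.le, le_rfl⟩)⟩,
      hlr.trans hts.2⟩, htr, hr2⟩
  -- `κ` is the sign of the level, so that `κ * y` is `|y|` along the curve.
  obtain ⟨κ, hκ, hκl⟩ : ∃ κ : ℝ, κ ^ 2 = 1 ∧ 0 ≤ κ * level σ (x 0, y 0) := by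
    rcases le_total 0 (level σ (x 0, y 0)) with h | h
    · exact ⟨1, by norm_num, by simpa⟩
    · exact ⟨-1, by norm_num, by simpa⟩
  have hκy : ∀ t ∈ Icc 0 (X + b), 0 ≤ κ * y t := by
    intro t ht
    have e : y t = gauss σ (level σ (x 0, y 0)) (x t) := by
      rw [← (hall ht).2]; exact (gauss_level σ (x t, y t)).symm
    rw [e, gauss, ← mul_assoc]
    exact mul_nonneg hκl (Real.exp_pos _).le
  -- For `x ≥ 0` the height `|y|` does not increase, so `x - |y|` grows at rate `v₁ + |v₂| ≥ 1`. As
  -- it starts above `-b`, at time `X + b` it exceeds `X`, contradicting `x ≤ X`.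
  have hgrow : MonotoneOn (fun t => x t - κ * y t - t) (Icc 0 (X + b)) := by
    have hd : ∀ t, HasDerivAt (fun t => x t - κ * y t - t) (v₁ t - κ * v₂ t - 1) t := fun t =>
      ((hx t).sub ((hy t).const_mul κ)).sub (hasDerivAt_id t)
    refine monotoneOn_of_deriv_nonneg (convex_Icc _ _) (by fun_prop)
      (fun q _ => (hd q).differentiableAt.differentiableWithinAt) fun q hq => ?_
    rw [interior_Icc] at hq
    have hq' := Ioo_subset_Icc_self hq
    rw [(hd q).deriv]
    have hW := hsW q (hall hq')
    have hv := hpos q hW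
    have hw : 0 ≤ -(κ * v₂ q) := by
      rw [htan q hW]
      have : 0 ≤ x q * (κ * y q) / σ ^ 2 * v₁ q :=
        mul_nonneg (div_nonneg (mul_nonneg (hall hq').1.1 (hκy q hq')) (sq_nonneg σ)) hv.le
      linarith [show -(κ * (-(x q * y q / σ ^ 2) * v₁ q)) = x q * (κ * y q) / σ ^ 2 * v₁ q by ring]
    have hu : v₁ q ^ 2 + (-(κ * v₂ q)) ^ 2 = 1 := by
      rw [neg_sq, mul_pow, hκ, one_mul, hunit]
    nlinarith
  have hfin := hgrow ⟨le_rfl, hT⟩ ⟨hT, le_rfl⟩ hT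
  have hy0 : κ * y 0 < b := by
    have h1 : |y 0| < b := h0.2.trans_le (gauss_le hb.le _)
    have h2 : |κ * y 0| = |y 0| := by
      rw [abs_mul, show |κ| = 1 by rw [← abs_one, ← sq_eq_sq_iff_abs_eq_abs, hκ, one_pow], one_mul]
    linarith [le_abs_self (κ * y 0)]
  have hyT := hκy (X + b) ⟨hT, le_rfl⟩
  have hxT := (hall ⟨hT, le_rfl⟩).1.2
  simp only [sub_zero] at hfin
  linarith

theorem exists_slide_left {σ a b X ε : ℝ} {x y v₁ v₂ : ℝ → ℝ} (hXa : X < a)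
    (hXb : X + b < ε)
    (hx : ∀ t, HasDerivAt x (v₁ t) t) (hy : ∀ t, HasDerivAt y (v₂ t) t)
    (hunit : ∀ t, v₁ t ^ 2 + v₂ t ^ 2 = 1)
    (hpos : ∀ t, (x t, y t) ∈ bump σ a b → 0 < v₁ t)
    (htan : ∀ t, (x t, y t) ∈ bump σ a b → v₂ t = -(x t * y t / σ ^ 2) * v₁ t)
    (h0 : (x 0, y 0) ∈ bump σ a b) (hx0 : x 0 ≤ 0) (hx0X : -X ≤ x 0) :
    ∃ t ∈ Ioc (-ε) 0, (x t, y t) ∈ bump σ a b ∧ x t < -X := by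
  have hsymm : ∀ x y : ℝ, (-x, y) ∈ bump σ a b ↔ (x, y) ∈ bump σ a b := fun x y => by
    simp [bump, gauss]
  -- Time reversal combined with the reflection `x ↦ -x` preserves all the assumptions.
  obtain ⟨t, ht, hW, hlt⟩ := exists_slide_right (σ := σ) (a := a) (b := b) (X := X) (ε := ε)
    (x := fun t => -x (-t)) (y := fun t => y (-t)) (v₁ := fun t => v₁ (-t))
    (v₂ := fun t => -v₂ (-t)) hXa hXb
    (fun t => ((hx (-t)).scomp t (hasDerivAt_neg t)).neg.congr_deriv (by simp))
    (fun t => ((hy (-t)).scomp t (hasDerivAt_neg t)).congr_deriv (by simp))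
    (fun t => by simpa using hunit (-t))
    (fun t ht => hpos (-t) ((hsymm _ _).1 ht))
    (fun t ht => by rw [htan (-t) ((hsymm _ _).1 ht)]; ring)
    (by simpa [hsymm] using h0) (by simpa using hx0) (by simpa using neg_le.1 hx0X)
  exact ⟨-t, ⟨by linarith [ht.2], by linarith [ht.1]⟩, (hsymm _ _).1 hW, by linarith⟩

/-! ### The persistent part of `W` -/

/-- The distance from the unstable axis beyond which the level of the Gaussian-shaped curves is
contracted by the factor `1 / λ`. -/
def coreRadius (σ : ℝ) : ℝ := σ * √(4 * Real.log expan / (1 - contr ^ 2))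

/-- The part of `W` away from the unstable axis, as a subset of the torus. -/
def core (ε b σ : ℝ) : Set Torus :=
  frame '' (regionW ε b σ ∩ {z | coreRadius σ < |z.1|})

theorem log_expan_pos : 0 < Real.log expan := Real.log_pos one_lt_expan

theorem one_sub_contr_sq_pos : 0 < 1 - contr ^ 2 := by
  nlinarith [contr_pos, contr_lt_one]

theorem coreRadius_pos {σ : ℝ} (hσ : 0 < σ) : 0 < coreRadius σ :=
  mul_pos hσ (Real.sqrt_pos.2 (div_pos (by linarith [log_expan_pos]) one_sub_contr_sq_pos))

theorem coreRadius_sq (σ : ℝ) :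
    coreRadius σ ^ 2 * (1 - contr ^ 2) = σ ^ 2 * (4 * Real.log expan) := by
  have := one_sub_contr_sq_pos
  rw [coreRadius, mul_pow, Real.sq_sqrt (div_nonneg (by linarith [log_expan_pos]) this.le)]
  field_simp

theorem halfLength_bounds {ε : ℝ} (hε : 0 < ε) : ε < halfLength ε ∧ halfLength ε < 1.619 * ε := by
  have h : (1 : ℝ) - contr = tau := by rw [contr_eq]; ring
  have ht := tau_bounds
  unfold halfLength
  rw [h]
  constructor
  · rw [lt_div_iff₀ (by linarith)]; nlinarith
  · rw [div_lt_iff₀ (by linarith)]; nlinarith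

theorem isOpen_core (ε b σ : ℝ) : IsOpen (core ε b σ) :=
  isOpenQuotientMap_frame.isOpenMap _
    ((isOpen_bump _ _ _).inter (isOpen_lt continuous_const (by fun_prop)))

section Field

variable {ε b β σ φ : ℝ} {V : Torus → ℝ × ℝ}

theorem IsKinkedField.tangent' (hV : IsKinkedField ε b β σ φ V) {z : ℝ × ℝ}
    (hz : z ∈ regionW ε b σ) :
    (V (frame z)).2 = -(z.1 * z.2 / σ ^ 2) * (V (frame z)).1 := by
  rw [hV.tangent z hz, (hasDerivAt_gauss _ _ _).deriv, gauss_level]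

theorem IsKinkedField.fst_ne_zero (hV : IsKinkedField ε b β σ φ V) {z : ℝ × ℝ}
    (hz : z ∈ regionW ε b σ) : (V (frame z)).1 ≠ 0 := by
  intro h
  have h1 := hV.unit (frame z)
  rw [hV.tangent' hz, h] at h1
  norm_num at h1

/-- `W` is star-shaped about the origin and the first component never vanishes there, so its sign at
the origin propagates along rays. -/
theorem IsKinkedField.fst_pos (hV : IsKinkedField ε b β σ φ V) (hb : 0 ≤ b) {z : ℝ × ℝ}
    (hz : z ∈ regionW ε b σ) : 0 < (V (frame z)).1 := by
  by_contra! hneg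
  have hc : Continuous fun s : ℝ => (V (frame (s • z))).1 :=
    (hV.smooth.continuous.comp (by fun_prop : Continuous fun s : ℝ => s • z)).fst
  have h0 : (V (frame ((0 : ℝ) • z))).1 = 1 := by
    rw [zero_smul]; exact congrArg Prod.fst hV.base
  obtain ⟨s, hs, hs0⟩ := intermediate_value_Icc' zero_le_one hc.continuousOn
    (show (0 : ℝ) ∈ Icc _ _ from ⟨by simpa using hneg, by simp only [h0]; exact zero_le_one⟩)
  exact hV.fst_ne_zero (smul_mem_bump hb hz hs) hs0

theorem catMap_core_subset (hσ : 0 < σ) {z : ℝ × ℝ} (hz : z ∈ regionW ε b σ)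
    (hX : coreRadius σ < |z.1|) : (contr * z.1, expan * z.2) ∈ regionW ε b σ := by
  have hz' := mem_bump_iff.1 hz
  refine mem_bump_iff.2 ⟨?_, lt_of_le_of_lt ?_ hz'.2⟩
  · rw [abs_mul, abs_of_pos contr_pos]
    exact (mul_le_of_le_one_left (abs_nonneg _) contr_lt_one.le).trans_lt hz'.1
  · have hX2 : coreRadius σ ^ 2 < z.1 ^ 2 := by
      rw [← sq_abs z.1]
      exact pow_lt_pow_left₀ hX (coreRadius_pos hσ).le two_ne_zero
    -- The logarithmic form of level non-increase: the gain `log λ` in height is outweighed by the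
    -- smaller `x`.
    have hkey : Real.log expan + (contr * z.1) ^ 2 / (2 * σ ^ 2) ≤ z.1 ^ 2 / (2 * σ ^ 2) := by
      rw [← le_sub_iff_add_le, ← sub_div, le_div_iff₀ (by positivity)]
      nlinarith [coreRadius_sq σ, one_sub_contr_sq_pos, log_expan_pos, sq_nonneg σ,
        mul_lt_mul_of_pos_right hX2 one_sub_contr_sq_pos, mul_nonneg (sq_nonneg σ) log_expan_pos.le]
    unfold level
    rw [abs_mul, abs_mul, abs_mul, Real.abs_exp, Real.abs_exp,
      abs_of_pos (zero_lt_one.trans one_lt_expan), mul_comm expan, mul_assoc]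
    refine mul_le_mul_of_nonneg_left ?_ (abs_nonneg _)
    rw [← Real.exp_log (zero_lt_one.trans one_lt_expan), ← Real.exp_add,
      Real.exp_log (zero_lt_one.trans one_lt_expan)]
    exact Real.exp_le_exp.2 hkey

theorem core_subset_steer (hb : 0 < b) (hσ : 0 < σ) (hB : 3 * (coreRadius σ + b) < ε)
    (hV : IsKinkedField ε b β σ φ V) {F : ℝ × ℝ → ℝ → ℝ × ℝ} (hF0 : ∀ z, F z 0 = z)
    (hF : ∀ z t, HasDerivAt (F z) (V (frame (F z t))) t)
    (hI : ∀ z t, integralCurve V (frame z) t = frame (F z t)) :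
    core ε b σ ⊆ steer V ε (core ε b σ) 1 := by
  rintro _ ⟨z, ⟨hz, hX⟩, rfl⟩
  have hX0 := coreRadius_pos hσ
  have hε : 0 < ε := by linarith
  have ha := (halfLength_bounds hε).1
  have hw := catMap_core_subset hσ hz hX
  set w : ℝ × ℝ := (contr * z.1, expan * z.2) with hwdef
  suffices h : ∃ t ∈ Ioo (-ε) ε, F w t ∈ regionW ε b σ ∧ coreRadius σ < |(F w t).1| by
    obtain ⟨t, ht, h⟩ := h
    exact ⟨t, ht, by rw [catMap_frame, hI]; exact ⟨_, h, rfl⟩⟩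
  have hx : ∀ t, HasDerivAt (fun t => (F w t).1) (V (frame (F w t))).1 t := fun t => (hF w t).fst
  have hy : ∀ t, HasDerivAt (fun t => (F w t).2) (V (frame (F w t))).2 t := fun t => (hF w t).snd
  by_cases hcase : coreRadius σ < |w.1|
  · exact ⟨0, ⟨by linarith, hε⟩, by rw [hF0]; exact ⟨hw, hcase⟩⟩
  have hc := abs_le.1 (not_lt.1 hcase)
  have hw0 : ((F w 0).1, (F w 0).2) ∈ bump σ (halfLength ε) b := by rw [hF0]; exact hw
  rcases le_total 0 w.1 with hs | hs
  · obtain ⟨t, ht, hW, hlt⟩ := exists_slide_right (ε := ε) (X := coreRadius σ) (by linarith)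
      (by linarith) hx hy (fun t => hV.unit _) (fun t ht => hV.fst_pos hb.le ht)
      (fun t ht => hV.tangent' ht) hw0 (by rw [hF0]; exact hs) (by rw [hF0]; exact hc.2)
    exact ⟨t, ⟨by linarith [ht.1], ht.2⟩, hW, hlt.trans_le (le_abs_self _)⟩
  · obtain ⟨t, ht, hW, hlt⟩ := exists_slide_left (ε := ε) (X := coreRadius σ) (by linarith)
      (by linarith) hx hy (fun t => hV.unit _) (fun t ht => hV.fst_pos hb.le ht)
      (fun t ht => hV.tangent' ht) hw0 (by rw [hF0]; exact hs) (by rw [hF0]; exact hc.1)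
    exact ⟨t, ⟨ht.1, by linarith [ht.2]⟩, hW, by linarith [neg_le_abs (F w t).1]⟩

end Field

/-! ### Steering into the core from everywhere -/

section Steering

variable {ε b β σ φ : ℝ} {V : Torus → ℝ × ℝ}

/-- Between `|x| = ε/10` and `|x| = 9ε/10` the Gaussian drops by more than the factor `λ ≥ (b + β) /
b`. Hence the height of a horizontal line inside `U'` at the outer abscissa is below that of `W` at
the inner one. -/
theorem gauss_near_lt (hb : 0 < b) (hσ : 0 < σ) (hX : 3 * coreRadius σ < ε)
    (hβ : b + β ≤ expan * b) {x : ℝ} (hx : |x| = 9 / 10 * ε) :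
    gauss σ (b + β) x < gauss σ b (1 / 10 * ε) := by
  have hX0 := coreRadius_pos hσ
  have hx2 : x ^ 2 = (9 / 10 * ε) ^ 2 := by rw [← sq_abs, hx]
  have hε2 : 36 * (σ ^ 2 * Real.log expan) ≤ ε ^ 2 := by
    have h1 : (3 * coreRadius σ) ^ 2 ≤ ε ^ 2 := by gcongr
    have h2 := coreRadius_sq σ
    nlinarith [sq_nonneg contr, sq_nonneg (coreRadius σ), mul_nonneg (sq_nonneg (coreRadius σ))
      (sq_nonneg contr)]
  have hpos : 0 < expan := zero_lt_one.trans one_lt_expan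
  calc gauss σ (b + β) x ≤ gauss σ (expan * b) x := by unfold gauss; gcongr
    _ = b * Real.exp (Real.log expan + -x ^ 2 / (2 * σ ^ 2)) := by
        rw [Real.exp_add, Real.exp_log hpos, gauss]; ring
    _ < gauss σ b (1 / 10 * ε) := by
        unfold gauss
        gcongr
        rw [← lt_sub_iff_add_lt, ← sub_div, lt_div_iff₀ (by positivity), hx2]
        nlinarith [mul_pos (sq_pos_of_pos hσ) log_expan_pos]

theorem exists_mem_steer_of_snd_ne_zero (hε : 0 < ε) {A : Set Torus} (hA : IsOpen A)
    (hne : A.Nonempty) {F : ℝ × ℝ → ℝ → ℝ × ℝ} (hF0 : ∀ z, F z 0 = z)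
    (hF : ∀ z t, HasDerivAt (F z) (V (frame (F z t))) t)
    (hI : ∀ z t, integralCurve V (frame z) t = frame (F z t)) {p : Torus}
    (hp : ∃ t ∈ Ioo (-ε) ε, (V (integralCurve V (catMap p) t)).2 ≠ 0) :
    ∃ n, p ∈ steer V ε A n := by
  obtain ⟨t₀, ht₀, hne0⟩ := hp
  obtain ⟨z, hz⟩ := frame_surjective (catMap p)
  rw [← hz, hI] at hne0
  have hy : HasDerivAt (fun t => (F z t).2) (V (frame (F z t₀))).2 t₀ := (hF z t₀).snd
  have hc : Continuous (F z) := continuous_iff_continuousAt.2 fun t => (hF z t).continuousAt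
  obtain ⟨t₁, ht₁, hne1⟩ : ∃ t₁ ∈ Ioo (-ε) ε, (F z t₀).2 ≠ (F z t₁).2 := by
    by_contra! h
    refine hne0 (hy.unique ((hasDerivAt_const t₀ (F z t₀).2).congr_of_eventuallyEq ?_))
    filter_upwards [Ioo_mem_nhds ht₀.1 ht₀.2] with t ht using (h t ht).symm
  obtain ⟨n, t, ht, hmem⟩ := exists_iterate_meets hA hne hc hne1
  have h0 : ∀ q, integralCurve V q 0 = q := fun q => by
    obtain ⟨w, rfl⟩ := frame_surjective q
    rw [hI, hF0]
  refine ⟨n + 1, t, (ordConnected_Ioo.uIcc_subset ht₀ ht₁) ht, ?_⟩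
  rw [← hz, hI]
  exact mem_steer_of_iterate hε h0 (by rwa [catMap_iterate_frame])

/-- A continuous plane curve whose projection stays in the projection of an injectively projected
open set stays in that set. -/
theorem mem_of_frame_mem {R : Set (ℝ × ℝ)} (hR : IsOpen R) (hinj : InjOn frame R) {S : Set ℝ}
    (hS : IsPreconnected S) {c : ℝ → ℝ × ℝ} (hc : Continuous c)
    (hcR : ∀ t ∈ S, frame (c t) ∈ frame '' R) {t₀ : ℝ} (ht₀ : t₀ ∈ S) (h0 : c t₀ ∈ R) :
    ∀ t ∈ S, c t ∈ R := by
  refine hS.subset_of_closure_inter_subset (hR.preimage hc) ⟨t₀, ht₀, h0⟩ ?_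
  rintro t ⟨ht, htS⟩
  obtain ⟨w, hw, hwt⟩ := hcR t htS
  obtain ⟨m, n, hmn⟩ := frame_eq_iff.1 hwt.symm
  -- At a limit time some translate of the curve is in `R`; at nearby times the curve and its
  -- translate both are, so injectivity kills the translation.
  have hopen : IsOpen {s | c s + deck m n ∈ R} := hR.preimage (by fun_prop)
  obtain ⟨s, hs1, hs2⟩ := mem_closure_iff.1 ht _ hopen (show c t + deck m n ∈ R from hmn ▸ hw)
  have : c s + deck m n = c s := hinj hs1 hs2 (frame_add_deck _ _ _)
  have hd : deck m n = 0 := by simpa using this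
  rw [hd, add_zero] at hmn
  rw [hmn] at hw
  exact hw

theorem mem_steer_of_snd_eq_zero (hb : 0 < b) (hσ : 0 < σ) (hβ0 : 0 < β)
    (hφ : Real.cos φ ≠ 0) (hU : InjOn frame (regionU ε b β σ))
    (hB : 3 * (coreRadius σ + b) < ε) (hβε : β < ε / 7) (hβb : b + β ≤ expan * b)
    (hV : IsKinkedField ε b β σ φ V) {F : ℝ × ℝ → ℝ → ℝ × ℝ} (hF0 : ∀ z, F z 0 = z)
    (hF : ∀ z t, HasDerivAt (F z) (V (frame (F z t))) t)
    (hI : ∀ z t, integralCurve V (frame z) t = frame (F z t)) {p : Torus}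
    (hp : ∀ t ∈ Ioo (-ε) ε, (V (integralCurve V (catMap p) t)).2 = 0) :
    p ∈ steer V ε (core ε b σ) 1 := by
  have hX0 := coreRadius_pos hσ
  have hε : 0 < ε := by linarith
  have ha := halfLength_bounds hε
  have h0mem : (0 : ℝ) ∈ Ioo (-ε) ε := ⟨by linarith, hε⟩
  have hU' : ∀ q, (V q).2 = 0 → q ∈ frame '' regionU' ε b β σ := by
    intro q hq
    by_contra h
    rcases hV.angle q h with h | h <;> rw [h] at hq <;> simp at hq <;> exact hφ hq
  obtain ⟨z, hz, hzp⟩ : catMap p ∈ frame '' regionU' ε b β σ := by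
    apply hU'
    obtain ⟨w, hw⟩ := frame_surjective (catMap p)
    have := hp 0 h0mem
    rwa [← hw, hI, hF0, hw] at this
  have hp' : ∀ t ∈ Ioo (-ε) ε, (V (frame (F z t))).2 = 0 := fun t ht => by
    rw [← hI, hzp]; exact hp t ht
  have hc : Continuous (F z) := continuous_iff_continuousAt.2 fun t => (hF z t).continuousAt
  have hmem : ∀ t ∈ Ioo (-ε) ε, F z t ∈ regionU' ε b β σ := by
    have hsub : regionU' ε b β σ ⊆ regionU ε b β σ := fun w hw =>
      ⟨hw.1.trans (by linarith), hw.2⟩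
    exact mem_of_frame_mem (isOpen_bump _ _ _) (hU.mono hsub)
      isPreconnected_Ioo hc (fun t ht => hU' _ (hp' t ht)) h0mem (by rwa [hF0])
  have hFx : ∀ t, HasDerivAt (fun t => (F z t).1) (V (frame (F z t))).1 t := fun t => (hF z t).fst
  have hFy : ∀ t, HasDerivAt (fun t => (F z t).2) (V (frame (F z t))).2 t := fun t => (hF z t).snd
  have hy : ∀ t ∈ Ioo (-ε) ε, (F z t).2 = z.2 := by
    intro t ht
    have := isOpen_Ioo.is_const_of_deriv_eq_zero isPreconnected_Ioo
      (f := fun t => (F z t).2) (s := Ioo (-ε) ε)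
      (fun t _ => (hFy t).differentiableAt.differentiableWithinAt)
      (fun t ht => by rw [(hFy t).deriv]; exact hp' t ht) ht h0mem
    simpa [hF0] using this
  obtain ⟨s, hs, hv⟩ : ∃ s : ℝ, s ^ 2 = 1 ∧ ∀ t ∈ Ioo (-ε) ε, (V (frame (F z t))).1 = s := by
    have hcont : Continuous fun t => (V (frame (F z t))).1 := (hV.smooth.continuous.comp hc).fst
    have hsq : EqOn ((fun t => (V (frame (F z t))).1) ^ 2) 1 (Ioo (-ε) ε) := fun t ht => by
      have := hV.unit (frame (F z t))
      rw [hp' t ht] at this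
      simpa using this
    rcases isPreconnected_Ioo.eq_one_or_eq_neg_one_of_sq_eq hcont.continuousOn hsq with h | h
    · exact ⟨1, by norm_num, h⟩
    · exact ⟨-1, by norm_num, h⟩
  have hx : ∀ t ∈ Ioo (-ε) ε, (F z t).1 = z.1 + s * t := by
    intro t ht
    have hd : ∀ t, HasDerivAt (fun t => (F z t).1 - s * t) ((V (frame (F z t))).1 - s) t :=
      fun t => ((hFx t).sub ((hasDerivAt_id t).const_mul s)).congr_deriv (by simp)
    have := isOpen_Ioo.is_const_of_deriv_eq_zero isPreconnected_Ioo
      (f := fun t => (F z t).1 - s * t) (s := Ioo (-ε) ε)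
      (fun t _ => (hd t).differentiableAt.differentiableWithinAt)
      (fun t ht => by rw [(hd t).deriv, hv t ht]; simp) ht h0mem
    simp [hF0] at this
    linarith
  have hpt : ∀ x, |x - z.1| < ε → ∃ t ∈ Ioo (-ε) ε, F z t = (x, z.2) := by
    intro x hxe
    have hs1 : |s| = 1 := by
      rw [← abs_one, ← sq_eq_sq_iff_abs_eq_abs, hs, one_pow]
    have ht : s * (x - z.1) ∈ Ioo (-ε) ε := by
      refine abs_lt.1 ?_
      rwa [abs_mul, hs1, one_mul]
    refine ⟨_, ht, Prod.ext ?_ (hy _ ht)⟩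
    rw [hx _ ht]
    linear_combination (x - z.1) * hs
  have hz1 := abs_lt.1 hz.1
  -- Otherwise the segment would reach the side of `U'`, at `a + β/2 < 1.619 ε + ε/14 < 1.7 ε`.
  have hzU : |z.1| ≤ 7 / 10 * ε := by
    rw [abs_le]
    constructor
    · by_contra! h
      obtain ⟨t, ht, hFt⟩ := hpt (-(halfLength ε + β / 2)) (by rw [abs_lt]; constructor <;> linarith)
      have := (hmem t ht).1
      rw [hFt, abs_neg, abs_of_pos (by linarith)] at this
      exact lt_irrefl _ this
    · by_contra! h
      obtain ⟨t, ht, hFt⟩ := hpt (halfLength ε + β / 2) (by rw [abs_lt]; constructor <;> linarith)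
      have := (hmem t ht).1
      rw [hFt, abs_of_pos (by linarith)] at this
      exact lt_irrefl _ this
  obtain ⟨hzl, hzr⟩ := abs_le.1 hzU
  obtain ⟨x, hxabs, hxz⟩ : ∃ x : ℝ, |x| = 9 / 10 * ε ∧ |x - z.1| < ε := by
    rcases le_total 0 z.1 with h | h
    · exact ⟨9 / 10 * ε, abs_of_pos (by linarith), by rw [abs_lt]; constructor <;> linarith⟩
    · exact ⟨-(9 / 10 * ε), by rw [abs_neg, abs_of_pos (by linarith)],
        by rw [abs_lt]; constructor <;> linarith⟩
  obtain ⟨t, ht, hFt⟩ := hpt x hxz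
  -- At nonzero height, the point of the segment with `x = ε/10` would lie in `W`, where the
  -- Gaussian curve through it has nonzero slope.
  have hz2 : z.2 = 0 := by
    by_contra hne
    obtain ⟨t', ht', hFt'⟩ := hpt (1 / 10 * ε) (by rw [abs_lt]; constructor <;> linarith)
    have hlt := (hmem t ht).2
    rw [hFt] at hlt
    have hW : F z t' ∈ regionW ε b σ := by
      rw [hFt']
      exact ⟨by rw [abs_of_pos (by linarith)]; linarith,
        hlt.trans (gauss_near_lt hb hσ (by linarith) hβb hxabs)⟩
    have h1 := hV.tangent' hW
    rw [hp' t' ht', hFt'] at h1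
    have h2 := hV.fst_ne_zero hW
    rw [hFt'] at h2
    have : 1 / 10 * ε * z.2 / σ ^ 2 ≠ 0 :=
      div_ne_zero (mul_ne_zero (by linarith) hne) (pow_ne_zero 2 hσ.ne')
    exact mul_ne_zero (neg_ne_zero.2 this) h2 h1.symm
  refine ⟨t, ht, ?_⟩
  rw [← hzp, hI, hFt, hz2]
  refine ⟨_, ⟨⟨?_, ?_⟩, ?_⟩, rfl⟩
  · simp only [hxabs]; linarith
  · simp only [abs_zero, gauss]; positivity
  · simp only [mem_ofPred_eq, hxabs]; linarith

end Steering

end KinkedCat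

end

theorem mainTheorem3 (ε b β σ φ : ℝ) (hb : 0 < b) (hβ : 0 < β) (hσ : 0 < σ)
    (hφ : -(Real.pi / 2) < φ ∧ φ < Real.pi / 2)
    (hU : Set.InjOn KinkedCat.frame (KinkedCat.regionU ε b β σ))
    (hB1 : ε > 3 * (σ * √(4 * Real.log KinkedCat.expan / (1 - KinkedCat.contr ^ 2)) + b))
    (hB2 : β < ε / 7 ∧ β ≤ (KinkedCat.expan - 1) * b)
    (hB3 : 1 / 4 * β > ε * Real.sin φ / (1 - KinkedCat.contr)
      + (b + β) * Real.exp (-(KinkedCat.halfLength ε + β) ^ 2 / (2 * σ ^ 2)) * Real.tan φ)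
    (V : KinkedCat.Torus → ℝ × ℝ) (hV : KinkedCat.IsKinkedField ε b β σ φ V) :
    ∃ (N : ℕ) (η : ℝ), 0 < η ∧
      ∀ (ν : MeasureTheory.Measure KinkedCat.Torus) [MeasureTheory.IsFiniteMeasure ν],
        ENNReal.ofReal η * ν (KinkedCat.setW ε b σ)ᶜ ≤
          ((KinkedCat.pushForward V ε)^[N] (ν.restrict (KinkedCat.setW ε b σ)ᶜ))
            (KinkedCat.setW ε b σ) := by
  open KinkedCat in
  obtain ⟨F, hF0, hF, hI, hc⟩ := exists_lifted_flow hV.smooth hV.unit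
  have hX0 := coreRadius_pos hσ
  have hB : 3 * (coreRadius σ + b) < ε := hB1
  have hε : 0 < ε := by linarith
  have ha := halfLength_bounds hε
  have hne : (core ε b σ).Nonempty := by
    -- The witness works since `coreRadius σ < ε < a`.
    refine ⟨_, ⟨(ε, 0), ⟨⟨?_, ?_⟩, ?_⟩, rfl⟩⟩
    · simpa [abs_of_pos hε] using ha.1
    · simp only [abs_zero, gauss]; positivity
    · simp only [Set.mem_ofPred_eq, abs_of_pos hε]; linarith
  have hW : MeasurableSet (setW ε b σ) :=
    (isOpenQuotientMap_frame.isOpenMap _ (isOpen_bump _ _ _)).measurableSet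
  obtain ⟨N, η, hη, h⟩ := exists_uniform_hit (ε := ε) hc (isOpen_core ε b σ)
    (Set.image_mono Set.inter_subset_left) hW (core_subset_steer hb hσ hB hV hF0 hF hI)
    (fun p => by
      by_cases hp : ∃ t ∈ Set.Ioo (-ε) ε, (V (integralCurve V (catMap p) t)).2 ≠ 0
      · exact exists_mem_steer_of_snd_ne_zero hε (isOpen_core ε b σ) hne hF0 hF hI hp
      · push Not at hp
        exact ⟨1, mem_steer_of_snd_eq_zero hb hσ hβ (Real.cos_pos_of_mem_Ioo hφ).ne' hU hB hB2.1
          (by linarith [hB2.2]) hV hF0 hF hI hp⟩)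
  refine ⟨N, η, by exact_mod_cast hη, fun ν _ => ?_⟩
  rw [pushForward_iterate_apply hc hW, ENNReal.ofReal_coe_nnreal]
  calc (η : ENNReal) * ν (setW ε b σ)ᶜ
      = ∫⁻ _, (η : ENNReal) ∂(ν.restrict (setW ε b σ)ᶜ) := by
        rw [MeasureTheory.lintegral_const, MeasureTheory.Measure.restrict_apply_univ]
    _ ≤ _ := MeasureTheory.lintegral_mono h
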